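/- Let $C$ be a pointed, full-dimensional polyhedral cone in a finite-dimensional real vector space, and let $\Gamma$ be a group of linear automorphisms of the space that map $C$ onto itself. Faces of $C$ include $C$ itself; a facet of a cone $K$ is a face of $K$ of dimension $\dim K-1$. Let $\mathbb H(C)$ be the set of facets of $C$, with an arbitrary linear order. For a face $F$ of $C$ let $\mathbb H(F)$ be the set of facets of $C$ containing $F$; call $F$ *cosimplicial* if $|\mathbb H(F)|=c$, where $c=\dim C-\dim F$, so that then $F=H_1\cap\dots\cap H_c$ with $\mathbb H(F)=\{H_1<\dots<H_c\}$. For a face $G$ of $C$ let $\min\operatorname{orbit}(G)$ be the face $G'$ in the $\Gamma$-orbit of $G$ for which $\mathbb H(G')$ is lexicographically smallest. Here either lexicographic convention may be used throughout: $A<B$ if the smallest element of the symmetric difference $A\,\triangle\,B$ lies in $A$ (comparing increasing lists), or $A<B$ if the largest element of $A\,\triangle\,B$ lies in $B$ (comparing $0$-$1$-vectors whose leading bit belongs to the largest facet). The orbit face-lattice algorithm starts with $\mathcal F=\emptyset$, $\mathcal W=\{C\}$. While $\mathcal W\neq\emptyset$, it does the following: - for each $F\in\mathcal W$ it forms $\mathcal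 E=\{F\cap H : H\in\mathbb H(C),\ H\notin\mathbb H(F)\}$ and puts $\min\operatorname{orbit}(G)$ into $\mathcal N$ for every inclusion-maximal $G\in\mathcal E$; - it then replaces $\mathcal F$ by $\mathcal F\cup\mathcal W$, $\mathcal W$ by $\mathcal N$, and $\mathcal N$ by $\emptyset$. When the loop ends, it returns $\mathcal F$. Modify the algorithm as follows for all cosimplicial faces $F=H_1\cap\dots\cap H_c$, or only for those in an arbitrarily chosen set of cosimplicial faces. For such $F$, let $\mathcal E=\{F\cap H : H\in\mathbb H(C),\ H>H_c\}$ (all $H\in\mathbb H(C)$ if $c=0$), and use $\{G\in\mathcal E : G\text{ is a facet of }F\}$ in place of the set of maximal elements of $\mathcal E$. Then the modified algorithm still computes all faces of $C$ up to orbit: it terminates and returns the same set $\mathcal F$ as the unmodified algorithm, $\mathcal F$ consists of faces of $C$, and every $\Gamma$-orbit of faces of $C$ contains exactly one element of $\mathcal F$. -/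

import Mathlib

namespace FaceLattice

variable {V : Type*} [AddCommGroup V] [Module ℝ V]

/-- A polyhedral cone: the intersection of finitely many linear half-spaces. -/
def IsPolyhedral (C : PointedCone ℝ V) : Prop :=
  C.DualFG (LinearMap.id : Module.Dual ℝ V →ₗ[ℝ] Module.Dual ℝ V)

/-- The dimension of a cone, i.e. the dimension of its linear hull. -/
noncomputable def dim (C : PointedCone ℝ V) : ℕ :=
  Module.finrank ℝ (Submodule.span ℝ (C : Set V))

/-- `H` is a facet of `C`: a face of dimension `dim C - 1`. -/
def IsFacetOf (H C : PointedCone ℝ V) : Prop :=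
  H.IsFaceOf C ∧ dim H + 1 = dim C

/-- The type of all facets of `C` (a structure, so that it carries no order by default). -/
structure Facet (C : PointedCone ℝ V) where
  cone : PointedCone ℝ V
  isFacetOf : IsFacetOf cone C

/-- The set `ℍ(F)` of the facets of `C` that contain `F`. -/
def facetsThrough (C F : PointedCone ℝ V) : Set (Facet C) :=
  {H | F ≤ H.cone}

/-- `F` is a cosimplicial face of `C`: a face that lies in exactly `dim C - dim F` facets of `C`. -/
def IsCosimplicial (C F : PointedCone ℝ V) : Prop :=
  F.IsFaceOf C ∧ (facetsThrough C F).encard + (dim F : ℕ∞) = (dim C : ℕ∞)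

/-- Lexicographic comparison of increasingly listed subsets of an ordered set, the smallest
elements being compared first: the smallest element of the symmetric difference lies in `A`. -/
def LexLT {ι : Type*} [LinearOrder ι] (A B : Set ι) : Prop :=
  ∃ a, a ∈ A ∧ a ∉ B ∧ ∀ b, b < a → (b ∈ A ↔ b ∈ B)

/-- Lexicographic comparison of the `0`-`1`-vectors of subsets of an ordered set, the bits of
the largest elements being compared first: the largest element of the symmetric difference
lies in `B`. -/
def ColexLT {ι : Type*} [LinearOrder ι] (A B : Set ι) : Prop :=
  ∃ b, b ∈ B ∧ b ∉ A ∧ ∀ a, b < a → (a ∈ A ↔ a ∈ B)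

/-- The orbit of a cone under a group of linear automorphisms of the ambient space. -/
def orbit (Γ : Subgroup (V ≃ₗ[ℝ] V)) (G : PointedCone ℝ V) : Set (PointedCone ℝ V) :=
  {K | ∃ g ∈ Γ, K = G.map (g : V →ₗ[ℝ] V)}

/-- `K = min orbit(G)`: the member of the orbit of `G` whose set of facets `ℍ(K)` is minimal with
respect to the comparison `lt` of sets of facets. -/
def IsMinOrbit (C : PointedCone ℝ V) (Γ : Subgroup (V ≃ₗ[ℝ] V))
    (lt : Set (Facet C) → Set (Facet C) → Prop) (G K : PointedCone ℝ V) : Prop :=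
  K ∈ orbit Γ G ∧ ∀ L ∈ orbit Γ G, ¬ lt (facetsThrough C L) (facetsThrough C K)

/-- The list `ℰ` of the unrestricted algorithm: all `F ∩ H` with `H ∉ ℍ(F)`. -/
def intersections (C F : PointedCone ℝ V) : Set (PointedCone ℝ V) :=
  {G | ∃ H : Facet C, H ∉ facetsThrough C F ∧ G = F ⊓ H.cone}

/-- The list `ℰ` of the restricted algorithm: all `F ∩ H` with `H` larger than every facet through
`F` (that is, `H > H_c` if `ℍ(F) = {H_1 < ... < H_c}`; no condition if `c = 0`). -/
def restrictedIntersections (C : PointedCone ℝ V) [LinearOrder (Facet C)] (F : PointedCone ℝ V) :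
    Set (PointedCone ℝ V) :=
  {G | ∃ H : Facet C, (∀ K ∈ facetsThrough C F, K < H) ∧ G = F ⊓ H.cone}

open scoped Classical in
/-- The faces `G` selected when the face `F` is processed. If `F` belongs to the set `R` of faces
to which the restriction is applied, these are the members of the restricted list that are facets
of `F`; otherwise they are the inclusion-maximal members of the unrestricted list. -/
noncomputable def selected (C : PointedCone ℝ V) [LinearOrder (Facet C)]
    (R : Set (PointedCone ℝ V)) (F : PointedCone ℝ V) : Set (PointedCone ℝ V) :=
  if F ∈ R then {G ∈ restrictedIntersections C F | IsFacetOf G F}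
  else {G | Maximal (· ∈ intersections C F) G}

/-- The set `𝒩` produced by one round of the `while` loop from the list `𝒲`. -/
def nextRound (C : PointedCone ℝ V) (Γ : Subgroup (V ≃ₗ[ℝ] V)) [LinearOrder (Facet C)]
    (lt : Set (Facet C) → Set (Facet C) → Prop) (R W : Set (PointedCone ℝ V)) :
    Set (PointedCone ℝ V) :=
  {K | ∃ F ∈ W, ∃ G ∈ selected C R F, IsMinOrbit C Γ lt G K}

/-- `Loop C Γ lt R 𝓕 W out`: the `while` loop, started with the sets `𝓕` and `W`, terminates and
returns `out`. -/
inductive Loop (C : PointedCone ℝ V) (Γ : Subgroup (V ≃ₗ[ℝ] V)) [LinearOrder (Facet C)]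
    (lt : Set (Facet C) → Set (Facet C) → Prop) (R : Set (PointedCone ℝ V)) :
    Set (PointedCone ℝ V) → Set (PointedCone ℝ V) → Set (PointedCone ℝ V) → Prop
  | done (𝓕 : Set (PointedCone ℝ V)) : Loop C Γ lt R 𝓕 ∅ 𝓕
  | round (𝓕 W out : Set (PointedCone ℝ V)) : W.Nonempty →
      Loop C Γ lt R (𝓕 ∪ W) (nextRound C Γ lt R W) out → Loop C Γ lt R 𝓕 W out

/-- The orbit face-lattice algorithm, with the restriction applied to the faces in `R`,
terminates and returns `out`. For `R = ∅` this is the unrestricted algorithm. -/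
def Returns (C : PointedCone ℝ V) (Γ : Subgroup (V ≃ₗ[ℝ] V)) [LinearOrder (Facet C)]
    (lt : Set (Facet C) → Set (Facet C) → Prop) (R out : Set (PointedCone ℝ V)) : Prop :=
  Loop C Γ lt R ∅ {C} out

end FaceLattice

/-!
Let `ℍ(F)` be the set of facets of `C` through `F`. Write `minFaces C Γ lt k` for the set of faces
of codimension `k` that are minimal in their orbits. In either version of the algorithm the list
`𝒲` of the `k`-th round is `minFaces C Γ lt k` (`nextRound_minFaces`), so both versions return the
union of these sets. This union meets every orbit of faces in exactly one element, because a face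
is determined by `ℍ(F)` and the lexicographic comparison is a strict total order.

That no orbit is lost by the restriction is an exchange argument. Given a face `K` of codimension
`k + 1` that is minimal in its orbit, let `F` be the lexicographically smallest face that has some
member `G` of the orbit of `K` as a facet. Then `F` is minimal in its own orbit, hence present in
round `k`. Suppose that `F` is cosimplicial and that `G` is missing from its restricted list. Then
all facets in `ℍ(G) \ ℍ(F)` are smaller than `M = max ℍ(F)`. As `F` is cosimplicial, there is a face
`E` covering `F` with `ℍ(E) = ℍ(F) \ {M}` (`IsCosimplicial.exists_facetsThrough_eq`), and by the
diamond property there is a second face `F' ≠ F` between `G` and `E`. Passing from `ℍ(F)` to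
`ℍ(F')` replaces `M` by smaller facets, so in both conventions `F'` precedes `F`, which contradicts
the choice of `F` (`IsCosimplicial.exists_lt`).

All facts needed about the face lattice follow from one property of polyhedral cones: a face `G`
and a point of the cone outside `G` are separated by a facet containing `G`
(`IsPolyhedral.exists_facet`). It applies to the faces of `C` as well, since these are polyhedral.
-/

namespace FaceLattice

/-! ### Faces of polyhedral cones -/

section Cone

variable {V : Type*} [AddCommGroup V] [Module ℝ V] {C F G : PointedCone ℝ V}

/-- The finite set `s` of linear functionals describes the cone `C` by linear inequalities. -/
def Describes (s : Finset (Module.Dual ℝ V)) (C : PointedCone ℝ V) : Prop :=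
  ∀ x, x ∈ C ↔ ∀ φ ∈ s, 0 ≤ φ x

theorem IsPolyhedral.exists_describes (hC : IsPolyhedral C) : ∃ s, Describes s C := by
  obtain ⟨s, rfl⟩ := hC
  exact ⟨s, fun x ↦ by simp [PointedCone.mem_dual]⟩

theorem Describes.isPolyhedral {s : Finset (Module.Dual ℝ V)} (hs : Describes s C) :
    IsPolyhedral C := by
  refine ⟨s, ?_⟩
  ext x
  simp [PointedCone.mem_dual, hs x]

/-- A point of `G` at which every functional of `s` that does not vanish on `G` is positive:
it plays the role of a point in the relative interior of `G`. -/
theorem Describes.exists_pos {s : Finset (Module.Dual ℝ V)} (hs : Describes s C) (hG : G ≤ C) :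
    ∃ x ∈ G, ∀ φ ∈ s, (∀ y ∈ G, φ y = 0) ∨ 0 < φ x := by
  have key : ∀ φ : Module.Dual ℝ V, ∃ y ∈ G, φ ∈ s → (∀ z ∈ G, φ z = 0) ∨ 0 < φ y := by
    intro φ
    by_cases h : ∀ z ∈ G, φ z = 0
    · exact ⟨0, G.zero_mem, fun _ ↦ Or.inl h⟩
    · push Not at h
      obtain ⟨z, hz, hne⟩ := h
      exact ⟨z, hz, fun hφ ↦ Or.inr (lt_of_le_of_ne ((hs z).1 (hG hz) φ hφ) hne.symm)⟩
  choose y hyG hy using key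
  refine ⟨∑ φ ∈ s, y φ, G.sum_mem fun φ _ ↦ hyG φ, fun φ hφ ↦ ?_⟩
  rcases hy φ hφ with h | h
  · exact Or.inl h
  · right
    rw [map_sum]
    exact Finset.sum_pos' (fun ψ _ ↦ (hs _).1 (hG (hyG ψ)) φ hφ) ⟨φ, hφ, h⟩

theorem Describes.exists_add_smul_mem {s : Finset (Module.Dual ℝ V)} (hs : Describes s C)
    {x v : V} (hx : x ∈ C) (h : ∀ φ ∈ s, 0 < φ x ∨ 0 ≤ φ v) :
    ∃ ε : ℝ, 0 < ε ∧ x + ε • v ∈ C := by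
  have key : ∀ φ ∈ s, ∀ᶠ ε in nhdsWithin (0 : ℝ) (Set.Ioi 0), 0 ≤ φ (x + ε • v) := by
    intro φ hφ
    rcases h φ hφ with h | h
    · have hc : Continuous fun ε : ℝ ↦ φ x + ε * φ v := by fun_prop
      have ht := hc.tendsto 0
      simp only [zero_mul, add_zero] at ht
      filter_upwards [(ht.eventually (lt_mem_nhds h)).filter_mono nhdsWithin_le_nhds] with ε hε
      simpa using hε.le
    · filter_upwards [self_mem_nhdsWithin] with ε hε
      have := (hs x).1 hx φ hφ
      have := mul_nonneg (le_of_lt hε) h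
      simp only [map_add, map_smul, smul_eq_mul]
      linarith
  obtain ⟨ε, h1, h2⟩ :=
    (((Finset.eventually_all s).2 key).and self_mem_nhdsWithin).exists
  exact ⟨ε, h2, (hs _).2 h1⟩

theorem Describes.mem_face_iff {s : Finset (Module.Dual ℝ V)} (hs : Describes s C)
    (hF : F.IsFaceOf C) {x : V} :
    x ∈ F ↔ x ∈ C ∧ ∀ φ ∈ s, (∀ y ∈ F, φ y = 0) → φ x = 0 := by
  refine ⟨fun h ↦ ⟨hF.le h, fun φ _ hφ ↦ hφ x h⟩, fun ⟨hxC, hx⟩ ↦ ?_⟩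
  -- An interior point `z` of `F` is the sum of a point of `C` and a positive multiple of `x`.
  obtain ⟨z, hzF, hz⟩ := hs.exists_pos hF.le
  obtain ⟨ε, hε, hmem⟩ := hs.exists_add_smul_mem (v := -x) (hF.le hzF) fun φ hφ ↦ by
    rcases hz φ hφ with h | h
    · exact Or.inr (by simp [hx φ hφ h])
    · exact Or.inl h
  exact hF.mem_of_smul_add_mem hxC hmem hε (by simpa using hzF)

theorem IsPolyhedral.of_isFaceOf (hC : IsPolyhedral C) (hF : F.IsFaceOf C) : IsPolyhedral F := by
  classical
  obtain ⟨s, hs⟩ := hC.exists_describes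
  refine Describes.isPolyhedral
    (s := s ∪ (s.filter fun φ ↦ ∀ y ∈ F, φ y = 0).image fun φ ↦ -φ) fun x ↦ ?_
  constructor
  · intro hx φ hφ
    simp only [Finset.mem_union, Finset.mem_image, Finset.mem_filter] at hφ
    rcases hφ with hφ | ⟨ψ, ⟨-, hψ⟩, rfl⟩
    · exact (hs x).1 (hF.le hx) φ hφ
    · simp [hψ x hx]
  · intro h
    have hxC : x ∈ C := (hs x).2 fun φ hφ ↦ h φ (Finset.mem_union_left _ hφ)
    refine (hs.mem_face_iff hF).2 ⟨hxC, fun φ hφ h0 ↦ le_antisymm ?_ ((hs x).1 hxC φ hφ)⟩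
    have := h (-φ) (Finset.mem_union_right _
      (Finset.mem_image_of_mem _ (Finset.mem_filter.2 ⟨hφ, h0⟩)))
    simpa using this

theorem IsPolyhedral.finite_faces (hC : IsPolyhedral C) :
    {F : PointedCone ℝ V | F.IsFaceOf C}.Finite := by
  classical
  obtain ⟨s, hs⟩ := hC.exists_describes
  refine Set.Finite.of_injOn
    (f := fun F : PointedCone ℝ V ↦ s.filter fun φ ↦ ∀ y ∈ F, φ y = 0)
    (t := (s.powerset : Set (Finset (Module.Dual ℝ V)))) (fun F _ ↦ ?_) ?_ (Finset.finite_toSet _)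
  · exact Finset.mem_coe.2 (Finset.mem_powerset.2 (Finset.filter_subset _ _))
  · intro F hF G hG h
    have h' : ∀ φ ∈ s, (∀ y ∈ F, φ y = 0) ↔ ∀ y ∈ G, φ y = 0 := fun φ hφ ↦ by
      simpa [hφ] using Finset.ext_iff.1 h φ
    ext x
    rw [hs.mem_face_iff hF, hs.mem_face_iff hG]
    exact and_congr_right fun _ ↦ forall₂_congr fun φ hφ ↦ by rw [h' φ hφ]

theorem IsPolyhedral.mem_of_mem_span (hC : IsPolyhedral C) (hF : F.IsFaceOf C) {x : V}
    (hx : x ∈ C) (hspan : x ∈ Submodule.span ℝ (F : Set V)) : x ∈ F := by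
  obtain ⟨s, hs⟩ := hC.exists_describes
  refine (hs.mem_face_iff hF).2 ⟨hx, fun φ _ h ↦ ?_⟩
  have : Submodule.span ℝ (F : Set V) ≤ LinearMap.ker φ := Submodule.span_le.2 h
  exact this hspan

/-- The part of a cone on which a functional, nonnegative on the cone, vanishes. -/
def zeroFace (C : PointedCone ℝ V) (φ : Module.Dual ℝ V) : PointedCone ℝ V :=
  C ⊓ (LinearMap.ker φ).restrictScalars _

theorem mem_zeroFace {φ : Module.Dual ℝ V} {x : V} : x ∈ zeroFace C φ ↔ x ∈ C ∧ φ x = 0 := by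
  simp [zeroFace]

theorem isFaceOf_zeroFace {φ : Module.Dual ℝ V} (h : ∀ x ∈ C, 0 ≤ φ x) :
    (zeroFace C φ).IsFaceOf C := by
  refine PointedCone.IsFaceOf.of_mem_of_add_mem_left inf_le_left fun {x y} hx hy hxy ↦ ?_
  have h1 := (mem_zeroFace.1 hxy).2
  rw [map_add] at h1
  exact mem_zeroFace.2 ⟨hx, by linarith [h x hx, h y hy]⟩

variable [FiniteDimensional ℝ V]

theorem dim_mono (h : F ≤ G) : dim F ≤ dim G :=
  Submodule.finrank_mono (Submodule.span_mono h)

theorem IsPolyhedral.dim_lt (hC : IsPolyhedral C) (hF : F.IsFaceOf C) (hG : G ≤ C)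
    (h : F < G) : dim F < dim G := by
  refine lt_of_le_of_ne (dim_mono h.le) fun he ↦ h.not_ge fun x hx ↦ ?_
  refine hC.mem_of_mem_span hF (hG hx) ?_
  rw [Submodule.eq_of_le_of_finrank_eq (Submodule.span_mono h.le) he]
  exact Submodule.subset_span hx

theorem IsPolyhedral.eq_of_le_of_dim_le (hC : IsPolyhedral C) (hF : F.IsFaceOf C) (hG : G ≤ C)
    (h : F ≤ G) (hd : dim G ≤ dim F) : F = G := by
  by_contra hne
  exact (hC.dim_lt hF hG (lt_of_le_of_ne h hne)).not_ge hd

/-- The facets of a polyhedral cone containing a face `G` separate `G` from the other points of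
the cone; so `G` is the intersection of these facets and the cone. -/
theorem IsPolyhedral.exists_facet (hC : IsPolyhedral C) (hG : G.IsFaceOf C) {x : V} (hx : x ∈ C)
    (hxG : x ∉ G) : ∃ K, IsFacetOf K C ∧ G ≤ K ∧ x ∉ K := by
  -- `K` is a maximal face containing `G` but not `x`.
  obtain ⟨K, ⟨hKC, hGK, hxK⟩, hmax⟩ :=
    (hC.finite_faces.subset (t := {K | K.IsFaceOf C ∧ G ≤ K ∧ x ∉ K}) fun K h ↦ h.1).exists_maximal
      ⟨G, hG, le_rfl, hxG⟩
  refine ⟨K, ⟨hKC, le_antisymm (hC.dim_lt hKC le_rfl (lt_of_le_of_ne hKC.le ?_)) ?_⟩, hGK, hxK⟩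
  · rintro rfl
    exact hxK hx
  by_contra! hlt
  obtain ⟨s, hs⟩ := hC.exists_describes
  -- As `K` has codimension at least two, some `z ∈ C` is independent of `x` modulo `K`.
  obtain ⟨z, hzC, hz⟩ : ∃ z ∈ C, z ∉ Submodule.span ℝ (K : Set V) ⊔ Submodule.span ℝ {x} := by
    by_contra! hcon
    have h1 : Submodule.span ℝ (C : Set V) ≤ _ := Submodule.span_le.2 hcon
    have h2 := Submodule.finrank_mono h1
    have h3 := Submodule.finrank_add_le_finrank_add_finrank
      (Submodule.span ℝ (K : Set V)) (Submodule.span ℝ {x})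
    have h4 : Module.finrank ℝ (Submodule.span ℝ {x}) ≤ 1 :=
      (finrank_span_le_card {x}).trans (by simp)
    unfold dim at hlt
    omega
  -- From `z` walk in direction `-x`, as far as the inequalities active on `K` permit.
  classical
  set T := s.filter fun φ ↦ (∀ y ∈ K, φ y = 0) ∧ 0 < φ x with hT
  have hTne : T.Nonempty := by
    by_contra hemp
    rw [Finset.not_nonempty_iff_eq_empty] at hemp
    refine hxK ((hs.mem_face_iff hKC).2 ⟨hx, fun φ hφ h0 ↦ ?_⟩)
    by_contra hne
    have : φ ∈ T := Finset.mem_filter.2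
      ⟨hφ, h0, lt_of_le_of_ne ((hs x).1 hx φ hφ) (Ne.symm hne)⟩
    simp [hemp] at this
  obtain ⟨φ, hφT, hφ⟩ := T.exists_min_image (fun φ ↦ φ z / φ x) hTne
  obtain ⟨hφs, hφK, hφx⟩ := Finset.mem_filter.1 hφT
  set p := z - (φ z / φ x) • x with hp
  have hφp : φ p = 0 := by simp [hp, hφx.ne']
  have ht : 0 ≤ φ z / φ x := div_nonneg ((hs z).1 hzC φ hφs) hφx.le
  have hpK : p ∉ Submodule.span ℝ (K : Set V) := fun h ↦ by
    refine hz ?_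
    have : z = p + (φ z / φ x) • x := by simp [hp]
    rw [this]
    exact Submodule.add_mem_sup h (Submodule.smul_mem _ _ (Submodule.mem_span_singleton_self x))
  obtain ⟨w, hwK, hw⟩ := hs.exists_pos hKC.le
  obtain ⟨ε, hε, hmem⟩ := hs.exists_add_smul_mem (v := p) (hKC.le hwK) fun ψ hψ ↦ by
    rcases hw ψ hψ with h | h
    · right
      have hψz := (hs z).1 hzC ψ hψ
      have hψx := (hs x).1 hx ψ hψ
      simp only [hp, map_sub, map_smul, smul_eq_mul, sub_nonneg]
      rcases hψx.eq_or_lt with h0 | h0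
      · simpa [← h0] using hψz
      · have := hφ ψ (Finset.mem_filter.2 ⟨hψ, h, h0⟩)
        rwa [le_div_iff₀ h0] at this
    · exact Or.inl h
  -- The end point lies in the face cut out by `φ`, which is thus larger than `K`.
  have hle : zeroFace C φ ≤ K := hmax
    ⟨isFaceOf_zeroFace fun y hy ↦ (hs y).1 hy φ hφs,
      fun y hy ↦ mem_zeroFace.2 ⟨hG.le hy, hφK y (hGK hy)⟩,
      fun h ↦ hφx.ne' (mem_zeroFace.1 h).2⟩
    fun y hy ↦ mem_zeroFace.2 ⟨hKC.le hy, hφK y hy⟩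
  have hin : w + ε • p ∈ K := hle (mem_zeroFace.2 ⟨hmem, by simp [hφp, hφK w hwK]⟩)
  refine hpK ?_
  have h1 := Submodule.sub_mem _ (Submodule.subset_span (R := ℝ) hin)
    (Submodule.subset_span (R := ℝ) hwK)
  rw [add_sub_cancel_left] at h1
  exact (Submodule.smul_mem_iff _ hε.ne').1 h1

end Cone

/-! ### Lexicographic orders on subsets -/

section Order

variable {ι : Type*} [LinearOrder ι]

/-- The properties, common to both lexicographic conventions, on which the algorithm relies: a
strict total order of the subsets in which a set gets smaller when its element `m` is replaced
by elements below `m`. -/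
structure IsLexOrder (lt : Set ι → Set ι → Prop) : Prop where
  irrefl : ∀ A, ¬ lt A A
  trans : ∀ A B D, lt A B → lt B D → lt A D
  eq_of_not_lt : ∀ A B, ¬ lt A B → ¬ lt B A → A = B
  exchange : ∀ (A B : Set ι) (m : ι), m ∈ A → m ∉ B → A \ {m} ⊆ B → (B \ A).Nonempty →
    (∀ b ∈ B \ A, b < m) → lt B A

theorem lexLT_trans {A B D : Set ι} (h₁ : LexLT A B) (h₂ : LexLT B D) : LexLT A D := by
  obtain ⟨a, haA, haB, ha⟩ := h₁
  obtain ⟨b, hbB, hbD, hb⟩ := h₂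
  rcases lt_trichotomy a b with h | rfl | h
  · exact ⟨a, haA, fun haD ↦ haB ((hb a h).2 haD), fun c hc ↦ (ha c hc).trans (hb c (hc.trans h))⟩
  · exact absurd hbB haB
  · exact ⟨b, (ha b h).2 hbB, hbD, fun c hc ↦ (ha c (hc.trans h)).trans (hb c hc)⟩

theorem eq_of_not_lexLT [Finite ι] {A B : Set ι} (h₁ : ¬ LexLT A B) (h₂ : ¬ LexLT B A) :
    A = B := by
  by_contra hne
  obtain ⟨a, ha, hmin⟩ := (wellFounded_lt (α := ι)).has_min {a | ¬ (a ∈ A ↔ a ∈ B)} (by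
    by_contra hemp
    rw [Set.not_nonempty_iff_eq_empty, Set.eq_empty_iff_forall_notMem] at hemp
    exact hne (Set.ext fun a ↦ not_not.1 (hemp a)))
  have hbelow : ∀ b, b < a → (b ∈ A ↔ b ∈ B) := fun b hb ↦ by
    by_contra h
    exact hmin b h hb
  by_cases haA : a ∈ A
  · exact h₁ ⟨a, haA, fun haB ↦ ha (iff_of_true haA haB), hbelow⟩
  · exact h₂ ⟨a, by_contra fun haB ↦ ha (iff_of_false haA haB), haA, fun b hb ↦ (hbelow b hb).symm⟩

/-- The second convention is the first one for the reversed order, with the two sets swapped. -/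
theorem colexLT_iff {A B : Set ι} :
    ColexLT A B ↔ LexLT (OrderDual.ofDual ⁻¹' B) (OrderDual.ofDual ⁻¹' A) := by
  constructor
  · rintro ⟨b, hB, hA, h⟩
    exact ⟨OrderDual.toDual b, hB, hA, fun a ha ↦ (h (OrderDual.ofDual a) ha).symm⟩
  · rintro ⟨b, hB, hA, h⟩
    exact ⟨OrderDual.ofDual b, hB, hA, fun a ha ↦ (h (OrderDual.toDual a) ha).symm⟩

theorem isLexOrder_lexLT [Finite ι] : IsLexOrder (LexLT (ι := ι)) where
  irrefl A := fun ⟨_, h, h', _⟩ ↦ h' h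
  trans _ _ _ := lexLT_trans
  eq_of_not_lt _ _ := eq_of_not_lexLT
  exchange A B m _ _ hsub hne hlt := by
    obtain ⟨b, hb, hmin⟩ := (wellFounded_lt (α := ι)).has_min (B \ A) hne
    refine ⟨b, hb.1, hb.2, fun c hc ↦ ⟨fun hcB ↦ ?_, fun hcA ↦ ?_⟩⟩
    · by_contra hcA
      exact hmin c ⟨hcB, hcA⟩ hc
    · exact hsub ⟨hcA, (hc.trans (hlt b hb)).ne⟩

theorem isLexOrder_colexLT [Finite ι] : IsLexOrder (ColexLT (ι := ι)) where
  irrefl A := fun ⟨_, h, h', _⟩ ↦ h' h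
  trans _ _ _ h₁ h₂ := colexLT_iff.2 (lexLT_trans (colexLT_iff.1 h₂) (colexLT_iff.1 h₁))
  eq_of_not_lt A B h₁ h₂ := by
    rw [colexLT_iff] at h₁ h₂
    have : Finite ιᵒᵈ := ‹Finite ι›
    exact eq_of_not_lexLT (ι := ιᵒᵈ) h₂ h₁
  exchange A B m hmA hmB hsub _ hlt := by
    refine ⟨m, hmA, hmB, fun a ha ↦ ⟨fun haB ↦ ?_, fun haA ↦ hsub ⟨haA, ha.ne'⟩⟩⟩
    by_contra haA
    exact lt_asymm ha (hlt a ⟨haB, haA⟩)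

theorem IsLexOrder.wellFounded [Finite ι] {lt : Set ι → Set ι → Prop} (h : IsLexOrder lt) :
    WellFounded lt :=
  have : Std.Irrefl lt := ⟨h.irrefl⟩
  have : IsTrans (Set ι) lt := ⟨h.trans⟩
  Finite.wellFounded_of_trans_of_irrefl lt

end Order

/-! ### Facets through a face -/

section Facets

variable {V : Type*} [AddCommGroup V] [Module ℝ V] {C E F G : PointedCone ℝ V}

theorem IsPolyhedral.finite_facet (hC : IsPolyhedral C) : Finite (Facet C) := by
  have := hC.finite_faces.to_subtype
  refine Finite.of_injective
    (fun H : Facet C ↦ (⟨H.cone, H.isFacetOf.1⟩ : {F : PointedCone ℝ V | F.IsFaceOf C})) ?_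
  rintro ⟨H, _⟩ ⟨K, _⟩ h
  simpa using h

theorem facetsThrough_anti (h : F ≤ G) : facetsThrough C G ⊆ facetsThrough C F :=
  fun _ hH ↦ h.trans hH

theorem IsFacetOf.lt (h : IsFacetOf G F) : G < F := by
  refine lt_of_le_of_ne h.1.le ?_
  rintro rfl
  have := h.2
  omega

theorem IsFacetOf.exists_notMem (h : IsFacetOf G F) : ∃ x ∈ F, x ∉ G :=
  SetLike.exists_of_lt h.lt

variable [FiniteDimensional ℝ V]

theorem IsPolyhedral.le_of_facetsThrough_subset (hC : IsPolyhedral C) (hF : F.IsFaceOf C)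
    (hG : G ≤ C) (h : facetsThrough C F ⊆ facetsThrough C G) : G ≤ F := by
  intro x hx
  by_contra hxF
  obtain ⟨K, hK, hFK, hxK⟩ := hC.exists_facet hF (hG hx) hxF
  exact hxK (h (show (⟨K, hK⟩ : Facet C) ∈ facetsThrough C F from hFK) hx)

theorem IsPolyhedral.eq_of_facetsThrough_eq (hC : IsPolyhedral C) (hF : F.IsFaceOf C)
    (hG : G.IsFaceOf C) (h : facetsThrough C F = facetsThrough C G) : F = G :=
  le_antisymm (hC.le_of_facetsThrough_subset hG hF.le h.ge)
    (hC.le_of_facetsThrough_subset hF hG.le h.le)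

theorem IsPolyhedral.exists_mem_facetsThrough (hC : IsPolyhedral C) (hF : F.IsFaceOf C)
    (hne : F ≠ C) : ∃ H, H ∈ facetsThrough C F := by
  obtain ⟨x, hx, hxF⟩ := SetLike.exists_of_lt (lt_of_le_of_ne hF.le hne)
  obtain ⟨K, hK, hFK, -⟩ := hC.exists_facet hF hx hxF
  exact ⟨⟨K, hK⟩, hFK⟩

/-- A facet of a face `E` that lies in a facet `H` of `C` not containing `E` equals `E ⊓ H`. -/
theorem IsPolyhedral.eq_inf_of_isFacetOf (hC : IsPolyhedral C) (hE : E.IsFaceOf C)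
    (hG : IsFacetOf G E) {H : Facet C} (hGH : H ∈ facetsThrough C G)
    (hEH : H ∉ facetsThrough C E) : G = E ⊓ H.cone := by
  refine hC.eq_of_le_of_dim_le (hG.1.trans hE) (inf_le_left.trans hE.le)
    (le_inf hG.1.le hGH) ?_
  have h := hC.dim_lt (hE.inf_left H.isFacetOf.1) hE.le
    (lt_of_le_of_ne inf_le_left fun h ↦ hEH (inf_eq_left.1 h))
  have := hG.2
  omega

/-- For every facet `H` of `C` through `F` there is a face `E` covering `F` that does not lie
in `H`. -/
theorem IsPolyhedral.exists_isFacetOf_notMem (hC : IsPolyhedral C) (hF : F.IsFaceOf C)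
    {H : Facet C} (hH : H ∈ facetsThrough C F) :
    ∃ E, E.IsFaceOf C ∧ IsFacetOf F E ∧ H ∉ facetsThrough C E := by
  obtain ⟨E, ⟨hE, hFE, hEH⟩, hmin⟩ :=
    (hC.finite_faces.subset
      (t := {E | E.IsFaceOf C ∧ F ≤ E ∧ H ∉ facetsThrough C E}) fun K h ↦ h.1).exists_minimal
      ⟨C, .rfl, hF.le, fun h : C ≤ H.cone ↦ H.isFacetOf.lt.not_ge h⟩
  have hEpoly := hC.of_isFaceOf hE
  have hFE' : F.IsFaceOf E := (hF.isFaceOf_iff_le hE).2 hFE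
  -- By minimality of `E`, its only facet containing `F` is `E ⊓ H`.
  have key : ∀ K x, IsFacetOf K E → F ≤ K → x ∈ E → x ∉ K → K = E ⊓ H.cone := by
    intro K x hK hFK hxE hxK
    refine hC.eq_inf_of_isFacetOf hE hK ?_ hEH
    by_contra hKH
    exact hxK (hmin ⟨hK.1.trans hE, hFK, hKH⟩ hK.1.le hxE)
  have hlt : F < E := lt_of_le_of_ne hFE fun h ↦ hEH (h ▸ hH)
  obtain ⟨x, hxE, hxF⟩ := SetLike.exists_of_lt hlt
  obtain ⟨K, hK, hFK, hxK⟩ := hEpoly.exists_facet hFE' hxE hxF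
  refine ⟨E, hE, ?_, hEH⟩
  suffices F = K from this ▸ hK
  by_contra hne
  obtain ⟨y, hyK, hyF⟩ := SetLike.exists_of_lt (lt_of_le_of_ne hFK hne)
  have hyE := hK.1.le hyK
  obtain ⟨K', hK', hFK', hyK'⟩ := hEpoly.exists_facet hFE' hyE hyF
  rw [key K' y hK' hFK' hyE hyK', ← key K x hK hFK hxE hxK] at hyK'
  exact hyK' hyK

/-- The diamond property of the face lattice: between `G` and a face `E` two dimensions above it,
there is a second face besides `F`. -/
theorem IsPolyhedral.exists_ne_isFacetOf (hE : IsPolyhedral E) (hF : IsFacetOf F E)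
    (hG : IsFacetOf G F) : ∃ F', IsFacetOf F' E ∧ IsFacetOf G F' ∧ F' ≠ F := by
  obtain ⟨x, hxF, hxG⟩ := hG.exists_notMem
  have hGE := hG.1.trans hF.1
  obtain ⟨F', hF', hGF', hxF'⟩ := hE.exists_facet hGE (hF.1.le hxF) hxG
  refine ⟨F', hF', ⟨(hGE.isFaceOf_iff_le hF'.1).2 hGF', ?_⟩, ?_⟩
  · have h1 := hF.2
    have h2 := hF'.2
    have h3 := hG.2
    omega
  · rintro rfl
    exact hxF' hxF

/-- A face of codimension `c` lies in at least `c` facets. -/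
theorem IsPolyhedral.dim_le_dim_add_ncard (hC : IsPolyhedral C) :
    ∀ F : PointedCone ℝ V, F.IsFaceOf C → dim C ≤ dim F + (facetsThrough C F).ncard := by
  have := hC.finite_facet
  have key : ∀ n, ∀ F : PointedCone ℝ V, F.IsFaceOf C → dim C ≤ dim F + n →
      dim C ≤ dim F + (facetsThrough C F).ncard := by
    intro n
    induction n with
    | zero => intro F _ h; omega
    | succ n ih =>
      intro F hF h
      rcases eq_or_ne F C with rfl | hne
      · omega
      obtain ⟨H, hH⟩ := hC.exists_mem_facetsThrough hF hne
      obtain ⟨E, hE, hFE, hHE⟩ := hC.exists_isFacetOf_notMem hF hH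
      have h1 := hFE.2
      have h2 := ih E hE (by omega)
      have h3 : (facetsThrough C E).ncard < (facetsThrough C F).ncard :=
        Set.ncard_lt_ncard ⟨facetsThrough_anti hFE.1.le, fun h ↦ hHE (h hH)⟩ (Set.toFinite _)
      omega
  exact fun F hF ↦ key (dim C) F hF (by omega)

/-- A facet through a cosimplicial face can be dropped: there is a face that lies in exactly the
other facets through `F`. -/
theorem IsCosimplicial.exists_facetsThrough_eq (hC : IsPolyhedral C) (hF : IsCosimplicial C F)
    {H : Facet C} (hH : H ∈ facetsThrough C F) :
    ∃ E, E.IsFaceOf C ∧ IsFacetOf F E ∧ facetsThrough C E = facetsThrough C F \ {H} := by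
  have := hC.finite_facet
  obtain ⟨E, hE, hFE, hHE⟩ := hC.exists_isFacetOf_notMem hF.1 hH
  refine ⟨E, hE, hFE, Set.eq_of_subset_of_ncard_le ?_ ?_ (Set.toFinite _)⟩
  · exact fun K hK ↦ ⟨facetsThrough_anti hFE.1.le hK, fun h ↦ hHE (h ▸ hK)⟩
  · have h1 : (facetsThrough C F).ncard + dim F = dim C := by
      have := hF.2
      rw [← Set.Finite.cast_ncard_eq (Set.toFinite _)] at this
      exact_mod_cast this
    have h2 := hC.dim_le_dim_add_ncard E hE
    have h3 := hFE.2
    rw [Set.ncard_sdiff_singleton_of_mem hH]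
    omega

/-- The maximal members of the unrestricted list of `F` are the facets of `F`. -/
theorem IsPolyhedral.maximal_intersections_iff (hC : IsPolyhedral C) (hF : F.IsFaceOf C) :
    Maximal (· ∈ intersections C F) G ↔ IsFacetOf G F := by
  constructor
  · rintro ⟨⟨H, hH, rfl⟩, hmax⟩
    obtain ⟨x, hxF, hxH⟩ := Set.not_subset.1 hH
    have hface : (F ⊓ H.cone).IsFaceOf F :=
      ((hF.inf_left H.isFacetOf.1).isFaceOf_iff_le hF).2 inf_le_left
    obtain ⟨K, hK, hle, hxK⟩ := (hC.of_isFaceOf hF).exists_facet hface hxF fun h ↦ hxH h.2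
    obtain ⟨H', hH'K, hH'F⟩ : ∃ H' ∈ facetsThrough C K, H' ∉ facetsThrough C F :=
      Set.not_subset.1 fun h ↦
        hK.lt.not_ge (hC.le_of_facetsThrough_subset (hK.1.trans hF) hF.le h)
    have := hmax ⟨H', hH'F, hC.eq_inf_of_isFacetOf hF hK hH'K hH'F⟩ hle
    rwa [le_antisymm hle this]
  · intro hG
    obtain ⟨H, hHG, hHF⟩ : ∃ H ∈ facetsThrough C G, H ∉ facetsThrough C F :=
      Set.not_subset.1 fun h ↦
        hG.lt.not_ge (hC.le_of_facetsThrough_subset (hG.1.trans hF) hF.le h)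
    refine ⟨⟨H, hHF, hC.eq_inf_of_isFacetOf hF hG hHG hHF⟩, ?_⟩
    rintro _ ⟨H', hH', rfl⟩ hle
    have hH'G : H' ∈ facetsThrough C G := hle.trans inf_le_right
    exact (hC.eq_inf_of_isFacetOf hF hG hH'G hH').ge

end Facets

/-! ### The selection step -/

section Selection

variable {V : Type*} [AddCommGroup V] [Module ℝ V] [FiniteDimensional ℝ V]
  {C F G : PointedCone ℝ V} [LinearOrder (Facet C)] {lt : Set (Facet C) → Set (Facet C) → Prop}
  {R : Set (PointedCone ℝ V)}

/-- The reason why the restriction loses no orbit: a facet `G` of a cosimplicial face `F` that the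
restricted list misses is also a facet of a face that precedes `F` in the lexicographic order. -/
theorem IsCosimplicial.exists_lt (hC : IsPolyhedral C) (hlt : IsLexOrder lt)
    (hF : IsCosimplicial C F) (hG : IsFacetOf G F) (hGF : G ∉ restrictedIntersections C F) :
    ∃ F', F'.IsFaceOf C ∧ IsFacetOf G F' ∧ lt (facetsThrough C F') (facetsThrough C F) := by
  have := hC.finite_facet
  have hGC := hG.1.trans hF.1
  have hnot : ∀ H ∈ facetsThrough C G, H ∉ facetsThrough C F →
      ∃ K ∈ facetsThrough C F, H ≤ K := by
    intro H hHG hHF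
    by_contra! hcon
    exact hGF ⟨H, hcon, hC.eq_inf_of_isFacetOf hF.1 hG hHG hHF⟩
  obtain ⟨H, hHG, hHF⟩ : ∃ H ∈ facetsThrough C G, H ∉ facetsThrough C F :=
    Set.not_subset.1 fun h ↦ hG.lt.not_ge (hC.le_of_facetsThrough_subset hGC hF.1.le h)
  -- `M` is the largest facet through `F`, so all further facets through `G` are below `M`.
  obtain ⟨M, hMF, hM⟩ := (Set.toFinite (facetsThrough C F)).exists_maximal
    ⟨_, (hnot H hHG hHF).choose_spec.1⟩
  have hbelow : ∀ H ∈ facetsThrough C G, H ∉ facetsThrough C F → H < M := by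
    intro H hHG hHF
    obtain ⟨K, hK, hHK⟩ := hnot H hHG hHF
    refine lt_of_le_of_ne (hHK.trans ?_) fun h ↦ hHF (h ▸ hMF)
    exact (le_total K M).elim id (hM hK)
  obtain ⟨E, hE, hFE, hHE⟩ := hF.exists_facetsThrough_eq hC hMF
  obtain ⟨F', hF'E, hGF', hne⟩ := (hC.of_isFaceOf hE).exists_ne_isFacetOf hFE hG
  have hF'C := hF'E.1.trans hE
  have hME : M ∉ facetsThrough C E := by simp [hHE]
  have hMF' : M ∉ facetsThrough C F' := fun h ↦ hne <|
    (hC.eq_inf_of_isFacetOf hE hF'E h hME).trans (hC.eq_inf_of_isFacetOf hE hFE hMF hME).symm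
  have hsub : facetsThrough C F \ {M} ⊆ facetsThrough C F' :=
    hHE ▸ facetsThrough_anti hF'E.1.le
  refine ⟨F', hF'C, hGF', hlt.exchange _ _ M hMF hMF' hsub ?_ ?_⟩
  · -- Otherwise `F` would lie in `F'`, although both have the same dimension.
    rw [Set.nonempty_iff_ne_empty, Ne, Set.sdiff_eq_empty]
    intro h
    refine hne (hC.eq_of_le_of_dim_le hF.1 hF'C.le
      (hC.le_of_facetsThrough_subset hF'C hF.1.le h) ?_).symm
    have h1 := hFE.2
    have h2 := hF'E.2
    omega
  · exact fun b hb ↦ hbelow b (facetsThrough_anti hGF'.1.le hb.1) hb.2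

theorem IsPolyhedral.isFacetOf_of_mem_selected (hC : IsPolyhedral C) (hF : F.IsFaceOf C)
    (h : G ∈ selected C R F) : IsFacetOf G F := by
  unfold selected at h
  split_ifs at h
  · exact h.2
  · exact (hC.maximal_intersections_iff hF).1 h

theorem IsPolyhedral.mem_selected_or (hC : IsPolyhedral C) (hF : F.IsFaceOf C)
    (h : IsFacetOf G F) : G ∈ selected C R F ∨ F ∈ R ∧ G ∉ restrictedIntersections C F := by
  unfold selected
  split_ifs with hR
  · by_cases hG : G ∈ restrictedIntersections C F
    · exact Or.inl ⟨hG, h⟩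
    · exact Or.inr ⟨hR, hG⟩
  · exact Or.inl ((hC.maximal_intersections_iff hF).2 h)

end Selection

/-! ### Orbits and the rounds of the algorithm -/

section Rounds

variable {V : Type*} [AddCommGroup V] [Module ℝ V] {C F G K : PointedCone ℝ V}
  {Γ : Subgroup (V ≃ₗ[ℝ] V)}

theorem mem_orbit_self (G : PointedCone ℝ V) : G ∈ orbit Γ G :=
  ⟨1, Γ.one_mem, by ext x; simp⟩

theorem mem_orbit_symm (h : K ∈ orbit Γ G) : G ∈ orbit Γ K := by
  obtain ⟨g, hg, rfl⟩ := h
  refine ⟨g⁻¹, Γ.inv_mem hg, ?_⟩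
  ext x
  simp [PointedCone.mem_map, LinearEquiv.coe_inv]

theorem mem_orbit_trans (h₁ : F ∈ orbit Γ G) (h₂ : K ∈ orbit Γ F) : K ∈ orbit Γ G := by
  obtain ⟨g, hg, rfl⟩ := h₁
  obtain ⟨g', hg', rfl⟩ := h₂
  refine ⟨g' * g, Γ.mul_mem hg' hg, ?_⟩
  ext x
  simp [PointedCone.mem_map]

theorem orbit_eq_of_mem (h : K ∈ orbit Γ G) : orbit Γ K = orbit Γ G :=
  Set.Subset.antisymm (fun _ ↦ mem_orbit_trans h) fun _ ↦ mem_orbit_trans (mem_orbit_symm h)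

theorem isFaceOf_of_mem_orbit (hΓ : ∀ g ∈ Γ, C.map (g : V →ₗ[ℝ] V) = C) (hG : G.IsFaceOf C)
    (h : K ∈ orbit Γ G) : K.IsFaceOf C := by
  obtain ⟨g, hg, rfl⟩ := h
  have := hG.map_equiv g
  rwa [hΓ g hg] at this

theorem dim_map (g : V ≃ₗ[ℝ] V) (G : PointedCone ℝ V) : dim (G.map (g : V →ₗ[ℝ] V)) = dim G := by
  unfold dim
  rw [PointedCone.coe_map, LinearEquiv.coe_coe, ← LinearEquiv.coe_coe g, Submodule.span_image]
  exact LinearEquiv.finrank_map_eq g _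

theorem dim_eq_of_mem_orbit (h : K ∈ orbit Γ G) : dim K = dim G := by
  obtain ⟨g, -, rfl⟩ := h
  exact dim_map g G

theorem IsFacetOf.map (h : IsFacetOf G F) (g : V ≃ₗ[ℝ] V) :
    IsFacetOf (G.map (g : V →ₗ[ℝ] V)) (F.map (g : V →ₗ[ℝ] V)) :=
  ⟨h.1.map_equiv g, by rw [dim_map, dim_map, h.2]⟩

/-- The faces of codimension `k` that are minimal in their orbits. -/
def minFaces (C : PointedCone ℝ V) (Γ : Subgroup (V ≃ₗ[ℝ] V))
    (lt : Set (Facet C) → Set (Facet C) → Prop) (k : ℕ) : Set (PointedCone ℝ V) :=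
  {K | K.IsFaceOf C ∧ dim K + k = dim C ∧ IsMinOrbit C Γ lt K K}

variable [LinearOrder (Facet C)] {lt : Set (Facet C) → Set (Facet C) → Prop}
  {R : Set (PointedCone ℝ V)}

/-- If each round turns `minFaces k` into `minFaces (k + 1)`, the loop terminates, since there are
no faces of codimension above `dim C`; the bound `n` on the number of rounds is only for the
induction. -/
theorem Loop.of_minFaces
    (h : ∀ k, nextRound C Γ lt R (minFaces C Γ lt k) = minFaces C Γ lt (k + 1)) (n : ℕ) :
    ∀ k, dim C + 1 ≤ k + n → ∀ 𝓕, Loop C Γ lt R 𝓕 (minFaces C Γ lt k)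
      (𝓕 ∪ ⋃ j ∈ Set.Ici k, minFaces C Γ lt j) := by
  -- Once a round produces nothing, neither do the later ones.
  have hempty : ∀ k, minFaces C Γ lt k = ∅ → ∀ j, minFaces C Γ lt (k + j) = ∅ := by
    intro k hk j
    induction j with
    | zero => exact hk
    | succ j ih =>
      rw [← add_assoc, ← h, ih]
      simp [nextRound]
  have hdone : ∀ k 𝓕, minFaces C Γ lt k = ∅ → Loop C Γ lt R 𝓕 (minFaces C Γ lt k)
      (𝓕 ∪ ⋃ j ∈ Set.Ici k, minFaces C Γ lt j) := by
    intro k 𝓕 hk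
    have : ⋃ j ∈ Set.Ici k, minFaces C Γ lt j = ∅ := by
      simp only [Set.iUnion_eq_empty]
      intro j hj
      obtain ⟨i, rfl⟩ := Nat.exists_eq_add_of_le hj
      exact hempty k hk i
    rw [this, hk, Set.union_empty]
    exact .done 𝓕
  induction n with
  | zero =>
    intro k hk 𝓕
    refine hdone k 𝓕 (Set.eq_empty_of_forall_notMem fun K hK ↦ ?_)
    have := hK.2.1
    omega
  | succ n ih =>
    intro k hk 𝓕
    rcases (minFaces C Γ lt k).eq_empty_or_nonempty with he | hne
    · exact hdone k 𝓕 he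
    refine .round _ _ _ hne ?_
    have := ih (k + 1) (by omega) (𝓕 ∪ minFaces C Γ lt k)
    rw [h k]
    convert this using 1
    rw [Set.union_assoc]
    congr 1
    ext x
    simp only [Set.mem_iUnion, Set.mem_union, Set.mem_Ici, exists_prop]
    constructor
    · rintro ⟨j, hj, hx⟩
      rcases hj.eq_or_lt with rfl | hj
      · exact Or.inl hx
      · exact Or.inr ⟨j, hj, hx⟩
    · rintro (hx | ⟨j, hj, hx⟩)
      · exact ⟨k, le_rfl, hx⟩
      · exact ⟨j, by omega, hx⟩

variable [FiniteDimensional ℝ V]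

theorem minFaces_zero (hC : IsPolyhedral C) (hΓ : ∀ g ∈ Γ, C.map (g : V →ₗ[ℝ] V) = C)
    (hlt : IsLexOrder lt) : minFaces C Γ lt 0 = {C} := by
  ext K
  simp only [Set.mem_singleton_iff]
  constructor
  · rintro ⟨hK, hd, -⟩
    exact hC.eq_of_le_of_dim_le hK le_rfl hK.le (by omega)
  · rintro rfl
    refine ⟨.rfl, by simp, mem_orbit_self _, ?_⟩
    rintro _ ⟨g, hg, rfl⟩
    rw [hΓ g hg]
    exact hlt.irrefl _

theorem nextRound_minFaces (hC : IsPolyhedral C) (hΓ : ∀ g ∈ Γ, C.map (g : V →ₗ[ℝ] V) = C)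
    (hlt : IsLexOrder lt) (hR : ∀ F ∈ R, IsCosimplicial C F) (k : ℕ) :
    nextRound C Γ lt R (minFaces C Γ lt k) = minFaces C Γ lt (k + 1) := by
  have := hC.finite_facet
  ext K
  constructor
  · rintro ⟨F, ⟨hF, hFd, -⟩, G, hG, hGK, hmin⟩
    have hGF := hC.isFacetOf_of_mem_selected hF hG
    refine ⟨isFaceOf_of_mem_orbit hΓ (hGF.1.trans hF) hGK, ?_, mem_orbit_self K, ?_⟩
    · have h1 := dim_eq_of_mem_orbit hGK
      have h2 := hGF.2
      omega
    · rwa [orbit_eq_of_mem hGK]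
  · rintro ⟨hK, hKd, -, hKmin⟩
    -- `F` is the smallest face that covers some member of the orbit of `K`. It is then minimal in
    -- its own orbit, and no smaller face is available for an exchange.
    obtain ⟨F, ⟨hF, G, hGK, hGF⟩, hFmin⟩ :=
      (InvImage.wf (facetsThrough C) hlt.wellFounded).has_min
        {F | F.IsFaceOf C ∧ ∃ G ∈ orbit Γ K, IsFacetOf G F} (by
          obtain ⟨H, hH⟩ := hC.exists_mem_facetsThrough hK (by rintro rfl; omega)
          obtain ⟨E, hE, hKE, -⟩ := hC.exists_isFacetOf_notMem hK hH
          exact ⟨E, hE, K, mem_orbit_self K, hKE⟩)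
    refine ⟨F, ⟨hF, ?_, mem_orbit_self F, ?_⟩, G, ?_, ?_⟩
    · have h1 := dim_eq_of_mem_orbit hGK
      have h2 := hGF.2
      omega
    · rintro L ⟨g, hg, rfl⟩
      exact hFmin _ ⟨isFaceOf_of_mem_orbit hΓ hF ⟨g, hg, rfl⟩, G.map (g : V →ₗ[ℝ] V),
        mem_orbit_trans hGK ⟨g, hg, rfl⟩, hGF.map g⟩
    · refine (hC.mem_selected_or hF hGF).resolve_right fun ⟨hFR, hG⟩ ↦ ?_
      obtain ⟨F', hF', hGF', hF'lt⟩ := (hR F hFR).exists_lt hC hlt hGF hG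
      exact hFmin F' ⟨hF', G, hGK, hGF'⟩ hF'lt
    · refine ⟨mem_orbit_symm hGK, ?_⟩
      rwa [orbit_eq_of_mem hGK]

theorem returns_iUnion_minFaces (hC : IsPolyhedral C)
    (hΓ : ∀ g ∈ Γ, C.map (g : V →ₗ[ℝ] V) = C) (hlt : IsLexOrder lt)
    (hR : ∀ F ∈ R, IsCosimplicial C F) : Returns C Γ lt R (⋃ k, minFaces C Γ lt k) := by
  have := Loop.of_minFaces (nextRound_minFaces hC hΓ hlt hR) (dim C + 1) 0 (by omega) ∅
  rw [minFaces_zero hC hΓ hlt] at this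
  simpa [Returns] using this

theorem existsUnique_mem_minFaces (hC : IsPolyhedral C)
    (hΓ : ∀ g ∈ Γ, C.map (g : V →ₗ[ℝ] V) = C) (hlt : IsLexOrder lt) (hF : F.IsFaceOf C) :
    ∃! G, G ∈ ⋃ k, minFaces C Γ lt k ∧ G ∈ orbit Γ F := by
  have := hC.finite_facet
  obtain ⟨G, hG, hmin⟩ := (InvImage.wf (facetsThrough C) hlt.wellFounded).has_min (orbit Γ F)
    ⟨F, mem_orbit_self F⟩
  have hGC := isFaceOf_of_mem_orbit hΓ hF hG
  refine ⟨G, ⟨Set.mem_iUnion.2 ⟨dim C - dim G, hGC, ?_, mem_orbit_self G, ?_⟩, hG⟩, ?_⟩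
  · have := dim_mono hGC.le
    omega
  · rwa [orbit_eq_of_mem hG]
  · rintro K ⟨hK, hKF⟩
    obtain ⟨k, hKC, -, -, hKmin⟩ := Set.mem_iUnion.1 hK
    rw [orbit_eq_of_mem hKF] at hKmin
    exact hC.eq_of_facetsThrough_eq hKC hGC (hlt.eq_of_not_lt _ _ (hmin K hKF) (hKmin G hG))

end Rounds

end FaceLattice

theorem propositionp {V : Type*} [AddCommGroup V] [Module ℝ V] [FiniteDimensional ℝ V]
    (C : PointedCone ℝ V) (hC : FaceLattice.IsPolyhedral C)
    (hfull : Submodule.span ℝ (C : Set V) = ⊤)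
    (hpointed : ∀ x ∈ C, -x ∈ C → x = 0)
    (Γ : Subgroup (V ≃ₗ[ℝ] V)) (hΓ : ∀ g ∈ Γ, C.map (g : V →ₗ[ℝ] V) = C)
    [LinearOrder (FaceLattice.Facet C)]
    (lt : Set (FaceLattice.Facet C) → Set (FaceLattice.Facet C) → Prop)
    (hlt : lt = FaceLattice.LexLT ∨ lt = FaceLattice.ColexLT)
    (R : Set (PointedCone ℝ V)) (hR : ∀ F ∈ R, FaceLattice.IsCosimplicial C F) :
    ∃ out : Set (PointedCone ℝ V),
      FaceLattice.Returns C Γ lt R out ∧ FaceLattice.Returns C Γ lt ∅ out ∧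
      (∀ G ∈ out, G.IsFaceOf C) ∧
      ∀ F : PointedCone ℝ V, F.IsFaceOf C → ∃! G, G ∈ out ∧ G ∈ FaceLattice.orbit Γ F := by
  have := hC.finite_facet
  have hlex : FaceLattice.IsLexOrder lt := by
    rcases hlt with rfl | rfl
    · exact FaceLattice.isLexOrder_lexLT
    · exact FaceLattice.isLexOrder_colexLT
  refine ⟨⋃ k, FaceLattice.minFaces C Γ lt k,
    FaceLattice.returns_iUnion_minFaces hC hΓ hlex hR,
    FaceLattice.returns_iUnion_minFaces hC hΓ hlex (by simp), fun G hG ↦ ?_,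
    fun F hF ↦ FaceLattice.existsUnique_mem_minFaces hC hΓ hlex hF⟩
  obtain ⟨k, hk⟩ := Set.mem_iUnion.1 hG
  exact hk.1
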